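/- For an integer $k$ and $n\ge 0$ let $B_n^{(k)}$ be Kaneko's poly-Bernoulli numbers, defined by $\sum_{n\ge 0}B_n^{(k)}\frac{x^n}{n!}=\frac{\mathrm{Li}_k(1-e^{-x})}{1-e^{-x}}$ (as formal power series), where $\mathrm{Li}_k(z)=\sum_{i\ge 1} z^i/i^k$, and put $B_{n,k}=B_n^{(-k)}$ for $n,k\ge 0$. A $01$ matrix is called lonesum if it is uniquely reconstructible from its row and column sums, i.e. it is the only $01$ matrix of its size with these row and column sums. Let $C_{n,k}$ be the number of lonesum $n\times k$ matrices in which each column contains at least one $1$, and let $D_{n,k}$ be the number of lonesum $n\times k$ matrices in which each column and each row contains at least one $1$ (empty matrices are allowed). For a finite graph $G$ let $\mathrm{chr}_G$ be its chromatic polynomial, i.e. the polynomial whose value at each natural number $q$ is the number of proper $q$-colorings of $G$, and let $K_{n,k}$ be the complete bipartite graph with parts of sizes $n$ and $k$. **Theorem 20.** For all integers $n,k\ge 0$: (i) $B_{n,k}=(-1)^{n+k}\,\mathrm{chr}_{K_{n,k}}(-1)$; (ii) $C_{n,k}=(-1)^{n+k}\,[q]\,\mathrm{chr}_{K_{n,k+1}}(q)$,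 where $[q]$ denotes the coefficient of $q^1$; (iii) $D_{n,k}=(-1)^{n+k}\left(\frac{d}{dq}\mathrm{chr}_{K_{n+1,k+1}}\right)(1)$. -/

import Mathlib

/-- The polylogarithm `Li_k(z) = ∑_{i ≥ 1} z^i / i^k` of integer order `k`, as a formal power
series in `z` with rational coefficients. -/
noncomputable def polylogSeries (k : ℤ) : PowerSeries ℚ :=
  PowerSeries.mk fun i => if i = 0 then 0 else 1 / (i : ℚ) ^ k

/-- The formal power series `1 - e^{-x}`. -/
noncomputable def oneSubExpNeg : PowerSeries ℚ :=
  1 - PowerSeries.rescale (-1) (PowerSeries.exp ℚ)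

/-- The formal power series `Li_k(z) / z = ∑_{i ≥ 0} z^i / (i + 1)^k`. -/
noncomputable def polylogDivSeries (k : ℤ) : PowerSeries ℚ :=
  PowerSeries.mk fun i => 1 / ((i : ℚ) + 1) ^ k

/-- The series `Li_k(1 - e^{-x}) / (1 - e^{-x})`: substitute `z = 1 - e^{-x}` in `Li_k(z) / z`. -/
noncomputable def polyBernoulliGenFun (k : ℤ) : PowerSeries ℚ :=
  (polylogDivSeries k).subst oneSubExpNeg

theorem hasSubst_oneSubExpNeg : PowerSeries.HasSubst oneSubExpNeg := by
  apply PowerSeries.HasSubst.of_constantCoeff_zero'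
  rw [← PowerSeries.coeff_zero_eq_constantCoeff_apply, oneSubExpNeg, map_sub,
    PowerSeries.coeff_rescale, PowerSeries.coeff_exp]
  simp

/-- The generating function is indeed the quotient of `Li_k(1 - e^{-x})` by `1 - e^{-x}`. -/
theorem polyBernoulliGenFun_mul (k : ℤ) :
    polyBernoulliGenFun k * oneSubExpNeg = (polylogSeries k).subst oneSubExpNeg := by
  have h : polylogSeries k = polylogDivSeries k * PowerSeries.X := by
    ext i
    cases i with
    | zero => simp [polylogSeries]
    | succ i => simp [polylogSeries, polylogDivSeries, PowerSeries.coeff_succ_mul_X]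
  rw [h, PowerSeries.subst_mul hasSubst_oneSubExpNeg, PowerSeries.subst_X hasSubst_oneSubExpNeg]
  rfl

theorem oneSubExpNeg_ne_zero : oneSubExpNeg ≠ 0 := by
  intro h
  have := congrArg (PowerSeries.coeff 1) h
  simp [oneSubExpNeg, PowerSeries.coeff_rescale, PowerSeries.coeff_exp,
    PowerSeries.coeff_one] at this

/-- Kaneko's poly-Bernoulli number `B_n^{(k)}`, for an integer `k`, given by
`∑_n B_n^{(k)} x^n / n! = Li_k(1 - e^{-x}) / (1 - e^{-x})`. -/
noncomputable def kanekoPolyBernoulli (n : ℕ) (k : ℤ) : ℚ :=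
  (n.factorial : ℚ) * PowerSeries.coeff n (polyBernoulliGenFun k)

/-- The poly-Bernoulli numbers of non-positive upper index: `B_{n,k} = B_n^{(-k)}`. -/
noncomputable def polyBernoulliB (n k : ℕ) : ℚ :=
  kanekoPolyBernoulli n (-(k : ℤ))

/-- The sum of the entries of row `i` of a `01` matrix (`true` is the entry `1`). -/
def rowSum {n k : ℕ} (M : Matrix (Fin n) (Fin k) Bool) (i : Fin n) : ℕ :=
  ∑ j, (M i j).toNat

/-- The sum of the entries of column `j` of a `01` matrix. -/
def colSum {n k : ℕ} (M : Matrix (Fin n) (Fin k) Bool) (j : Fin k) : ℕ :=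
  ∑ i, (M i j).toNat

/-- A `01` matrix is lonesum if it is uniquely reconstructible from its row sums and
column sums. -/
def IsLonesum {n k : ℕ} (M : Matrix (Fin n) (Fin k) Bool) : Prop :=
  ∀ M' : Matrix (Fin n) (Fin k) Bool, rowSum M' = rowSum M → colSum M' = colSum M → M' = M

/-- `C_{n,k}`: the number of lonesum `n × k` matrices without all-`0` columns. -/
noncomputable def lonesumC (n k : ℕ) : ℕ :=
  {M : Matrix (Fin n) (Fin k) Bool | IsLonesum M ∧ ∀ j, ∃ i, M i j = true}.ncard

/-- `D_{n,k}`: the number of lonesum `n × k` matrices without all-`0` columns and without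
all-`0` rows. -/
noncomputable def lonesumD (n k : ℕ) : ℕ :=
  {M : Matrix (Fin n) (Fin k) Bool |
    IsLonesum M ∧ (∀ j, ∃ i, M i j = true) ∧ ∀ i, ∃ j, M i j = true}.ncard

/-- A polynomial whose value at each natural number `q` is the number of proper `q`-colorings of
a finite graph exists and is unique. -/
theorem existsUnique_chromaticPolynomial {V : Type*} [Finite V] (G : SimpleGraph V) :
    ∃! p : Polynomial ℤ, ∀ q : ℕ, p.eval (q : ℤ) = (Nat.card (G.Coloring (Fin q)) : ℤ) := by
  classical
  have : Fintype V := Fintype.ofFinite V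
  have : Finite (Setoid V) :=
    Finite.of_injective (fun s : Setoid V => (fun a b => s a b : V → V → Prop))
      (fun s t h => Setoid.ext fun a b => by
        have := congrFun (congrFun h a) b
        exact iff_of_eq this)
  have : Fintype (Setoid V) := Fintype.ofFinite _
  have hinj : ∀ p p' : Polynomial ℤ, (∀ q : ℕ, p.eval (q : ℤ) = p'.eval (q : ℤ)) → p = p' := by
    intro p p' h
    apply Polynomial.eq_of_infinite_eval_eq
    refine Set.Infinite.mono ?_ (Set.infinite_range_of_injective (Nat.cast_injective (R := ℤ)))
    rintro _ ⟨q, rfl⟩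
    exact h q
  -- group the colorings by their partition of the vertices into color classes
  refine existsUnique_of_exists_of_unique ⟨∑ s : {s : Setoid V // ∀ a b, s a b → ¬ G.Adj a b},
      descPochhammer ℤ (Nat.card (Quotient s.1)), ?_⟩ ?_
  · intro q
    let e : G.Coloring (Fin q) ≃
        Σ s : {s : Setoid V // ∀ a b, s a b → ¬ G.Adj a b}, (Quotient s.1 ↪ Fin q) :=
      Equiv.ofBijective
        (fun c => ⟨⟨Setoid.ker c, fun a b h hab => c.valid hab h⟩,
          ⟨Quotient.lift c (fun a b h => h), by
            rintro ⟨a⟩ ⟨b⟩ h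
            exact Quotient.sound h⟩⟩)
        (by
          constructor
          · intro c c' h
            have key : ∀ x y : Σ s : {s : Setoid V // ∀ a b, s a b → ¬ G.Adj a b},
                (Quotient s.1 ↪ Fin q), x = y → ∀ a : V,
                x.2 (Quotient.mk x.1.1 a) = y.2 (Quotient.mk y.1.1 a) := by
              rintro x _ rfl a
              rfl
            exact DFunLike.ext _ _ fun a => key _ _ h a
          · rintro ⟨⟨s, hs⟩, f⟩
            let c : G.Coloring (Fin q) := SimpleGraph.Coloring.mk (fun a => f (Quotient.mk s a))
              (fun {a b} hab h => hs a b (Quotient.exact (f.injective h)) hab)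
            have hk : Setoid.ker c = s := by
              ext a b
              exact ⟨fun h => Quotient.exact (f.injective h),
                fun h => congrArg f (Quotient.sound h)⟩
            refine ⟨c, ?_⟩
            have aux : ∀ (t : Setoid V) (ht : ∀ a b, t a b → ¬ G.Adj a b)
                (g : Quotient t ↪ Fin q), t = s →
                (∀ a, g (Quotient.mk t a) = f (Quotient.mk s a)) →
                (⟨⟨t, ht⟩, g⟩ : Σ s : {s : Setoid V // ∀ a b, s a b → ¬ G.Adj a b},
                  (Quotient s.1 ↪ Fin q)) = ⟨⟨s, hs⟩, f⟩ := by
              rintro t ht g rfl hg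
              have : g = f := by
                ext x
                induction x using Quotient.inductionOn with
                | _ a => rw [hg]
              rw [this]
            exact aux _ _ _ hk (fun a => rfl))
    rw [Nat.card_congr e, Nat.card_sigma, Polynomial.eval_finsetSum]
    push_cast
    refine Finset.sum_congr rfl fun s _ => ?_
    rw [descPochhammer_eval_eq_descFactorial, Nat.card_eq_fintype_card, Nat.card_eq_fintype_card,
      Fintype.card_embedding_eq, Fintype.card_fin]
  · intro p p' hp hp'
    exact hinj p p' fun q => (hp q).trans (hp' q).symm

/-- The chromatic polynomial of a finite graph: the polynomial whose value at each natural number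
`q` is the number of proper `q`-colorings. -/
noncomputable def chromaticPolynomial {V : Type*} [Finite V] (G : SimpleGraph V) :
    Polynomial ℤ :=
  (existsUnique_chromaticPolynomial G).choose

theorem chromaticPolynomial_eval {V : Type*} [Finite V] (G : SimpleGraph V) (q : ℕ) :
    (chromaticPolynomial G).eval (q : ℤ) = (Nat.card (G.Coloring (Fin q)) : ℤ) :=
  (existsUnique_chromaticPolynomial G).choose_spec.1 q

/-! All three identities reduce to alternating sums over the Stirling numbers `S(n, m)` of the
second kind.

A proper `q`-coloring of `K_{n,k}` is a map `f` from the left part to the colors together with a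
map from the right part to the colors missed by `f`, and there are `S(n, m) q (q - 1) ⋯ (q - m + 1)`
maps `f` with an image of size `m`. Hence
`chr(q) = ∑_m S(n, m) q (q - 1) ⋯ (q - m + 1) (q - m)^k`
(`chromaticPolynomial_completeBipartiteGraph`). Up to the sign `(-1)^k`, its value at `-1` is
`∑_m (-1)^m m! S(n, m) (m + 1)^k`; the coefficient of `q` for `K_{n,k+1}` is
`∑_m (-1)^m m! S(n, m) m^k`; the derivative at `1` for `K_{n+1,k+1}` is
`∑_m (-1)^m m! S(n + 1, m + 1) m^k`.

For the poly-Bernoulli numbers, `g = 1 - e^{-x}` satisfies `g' = 1 - g`, which gives the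
coefficients of the powers of `g` (`factorial_mul_coeff_oneSubExpNeg_pow`), and substitution into
`∑_i (i + 1)^k z^i` produces the first sum.

A matrix is lonesum exactly if its columns form a chain of sets of rows
(`isLonesum_iff_isFerrers`). Classifying such matrices without zero columns by their nonzero rows
gives `C_{n,k} = ∑_u binom(n, u) D_{u,k}`. For `n ≥ 1`, having no zero row means having an all-`1`
column, and classifying by the other columns gives
`C_{n,k} = ∑_l binom(k, l) (C_{n,l} - D_{n,l})`. The two relations determine `C` and `D` by
recursion on `k`, and the second and the third sum satisfy them
(`sum_choose_mul_altStirlingSumShift`, `altStirlingSum_eq_shift_sub`). -/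

/-! ### Alternating Stirling sums -/

/-- The alternating Stirling sum `∑_m (-1)^m m! S(n, m) h(m)`, where `S(n, m)` are the Stirling
numbers of the second kind, as a functional of the weight `h`. -/
def altStirlingSum (n : ℕ) (h : ℕ → ℤ) : ℤ :=
  ∑ m ∈ Finset.range (n + 1), (-1) ^ m * m.factorial * n.stirlingSecond m * h m

/-- The shifted alternating Stirling sum `∑_m (-1)^m m! S(n + 1, m + 1) h(m)`. -/
def altStirlingSumShift (n : ℕ) (h : ℕ → ℤ) : ℤ :=
  ∑ m ∈ Finset.range (n + 1), (-1) ^ m * m.factorial * (n + 1).stirlingSecond (m + 1) * h m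

theorem altStirlingSum_add (n : ℕ) (h h' : ℕ → ℤ) :
    altStirlingSum n (fun m => h m + h' m) = altStirlingSum n h + altStirlingSum n h' := by
  simp only [altStirlingSum, mul_add, Finset.sum_add_distrib]

theorem altStirlingSumShift_add (n : ℕ) (h h' : ℕ → ℤ) :
    altStirlingSumShift n (fun m => h m + h' m) =
      altStirlingSumShift n h + altStirlingSumShift n h' := by
  simp only [altStirlingSumShift, mul_add, Finset.sum_add_distrib]

theorem altStirlingSum_sum {ι : Type*} (n : ℕ) (s : Finset ι) (c : ι → ℤ) (h : ι → ℕ → ℤ) :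
    altStirlingSum n (fun m => ∑ i ∈ s, c i * h i m) = ∑ i ∈ s, c i * altStirlingSum n (h i) := by
  simp only [altStirlingSum, Finset.mul_sum]
  rw [Finset.sum_comm]
  exact Finset.sum_congr rfl fun i _ => Finset.sum_congr rfl fun m _ => by ring

theorem altStirlingSumShift_sum {ι : Type*} (n : ℕ) (s : Finset ι) (c : ι → ℤ)
    (h : ι → ℕ → ℤ) :
    altStirlingSumShift n (fun m => ∑ i ∈ s, c i * h i m) =
      ∑ i ∈ s, c i * altStirlingSumShift n (h i) := by
  simp only [altStirlingSumShift, Finset.mul_sum]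
  rw [Finset.sum_comm]
  exact Finset.sum_congr rfl fun i _ => Finset.sum_congr rfl fun m _ => by ring

theorem altStirlingSum_eq_sum_range_succ (n : ℕ) (h : ℕ → ℤ) :
    altStirlingSum n h =
      ∑ m ∈ Finset.range (n + 2), (-1) ^ m * m.factorial * n.stirlingSecond m * h m := by
  rw [Finset.sum_range_succ, Nat.stirlingSecond_eq_zero_of_lt (Nat.lt_succ_self n)]
  simp [altStirlingSum]

theorem altStirlingSumShift_eq_sum_range_succ (n : ℕ) (h : ℕ → ℤ) :
    altStirlingSumShift n h =
      ∑ m ∈ Finset.range (n + 2),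
        (-1) ^ m * m.factorial * (n + 1).stirlingSecond (m + 1) * h m := by
  rw [Finset.sum_range_succ, Nat.stirlingSecond_eq_zero_of_lt (Nat.lt_succ_self (n + 1))]
  simp [altStirlingSumShift]

theorem altStirlingSum_succ (n : ℕ) (h : ℕ → ℤ) :
    altStirlingSum (n + 1) h = altStirlingSum n (fun m => m * h m - (m + 1) * h (m + 1)) := by
  have h1 : altStirlingSum n (fun m => m * h m - (m + 1) * h (m + 1)) =
      altStirlingSum n (fun m => m * h m) + altStirlingSum n (fun m => -((m + 1) * h (m + 1))) := by
    rw [← altStirlingSum_add]; simp only [sub_eq_add_neg]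
  rw [h1, altStirlingSum_eq_sum_range_succ n (fun m => m * h m), altStirlingSum, altStirlingSum,
    Finset.sum_range_succ', Finset.sum_range_succ' _ (n + 1), Nat.stirlingSecond_succ_zero,
    add_right_comm, ← Finset.sum_add_distrib]
  simp only [Nat.cast_zero, mul_zero, zero_mul, add_zero]
  refine Finset.sum_congr rfl fun m _ => ?_
  rw [Nat.stirlingSecond_succ_succ, Nat.factorial_succ]
  push_cast
  ring

theorem altStirlingSumShift_succ (n : ℕ) (h : ℕ → ℤ) :
    altStirlingSumShift (n + 1) h =
      altStirlingSumShift n (fun m => (m + 1) * h m - (m + 1) * h (m + 1)) := by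
  have h1 : altStirlingSumShift n (fun m => (m + 1) * h m - (m + 1) * h (m + 1)) =
      altStirlingSumShift n (fun m => (m + 1) * h m) +
        altStirlingSumShift n (fun m => -((m + 1) * h (m + 1))) := by
    rw [← altStirlingSumShift_add]; simp only [sub_eq_add_neg]
  have h2 : altStirlingSumShift n (fun m => -((m + 1) * h (m + 1))) =
      ∑ m ∈ Finset.range (n + 2), (-1) ^ m * m.factorial * (n + 1).stirlingSecond m * h m := by
    rw [altStirlingSumShift, Finset.sum_range_succ' _ (n + 1), Nat.stirlingSecond_succ_zero]
    simp only [Nat.cast_zero, mul_zero, zero_mul, add_zero]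
    refine Finset.sum_congr rfl fun m _ => ?_
    rw [Nat.factorial_succ]
    push_cast
    ring
  rw [h1, h2, altStirlingSumShift_eq_sum_range_succ n (fun m => (m + 1) * h m),
    altStirlingSumShift, ← Finset.sum_add_distrib]
  refine Finset.sum_congr rfl fun m _ => ?_
  rw [Nat.stirlingSecond_succ_succ]
  push_cast
  ring

/-- A signed form of the identity `S(n + 1, m + 1) = ∑_u C(n, u) S(u, m)`, inverted binomially. -/
theorem sum_choose_mul_altStirlingSumShift (n : ℕ) (h : ℕ → ℤ) :
    ∑ u ∈ Finset.range (n + 1), (n.choose u : ℤ) * ((-1) ^ u * altStirlingSumShift u h) =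
      (-1) ^ n * altStirlingSum n h := by
  induction n generalizing h with
  | zero => simp [altStirlingSum, altStirlingSumShift, Nat.stirlingSecond_one_right]
  | succ n ih =>
    have hpascal : ∀ a : ℕ → ℤ, ∑ u ∈ Finset.range (n + 2), ((n + 1).choose u : ℤ) * a u =
        ∑ u ∈ Finset.range (n + 1), (n.choose u : ℤ) * (a u + a (u + 1)) := by
      intro a
      have h0 : ∑ u ∈ Finset.range (n + 1), (n.choose u : ℤ) * a u =
          ∑ u ∈ Finset.range (n + 2), (n.choose u : ℤ) * a u := by
        rw [Finset.sum_range_succ _ (n + 1), Nat.choose_succ_self]; simp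
      simp only [mul_add, Finset.sum_add_distrib]
      rw [h0, Finset.sum_range_succ', Finset.sum_range_succ' _ (n + 1), add_right_comm,
        ← Finset.sum_add_distrib]
      simp only [Nat.choose_zero_right]
      congr 1
      refine Finset.sum_congr rfl fun u _ => ?_
      rw [Nat.choose_succ_succ]
      push_cast
      ring
    rw [hpascal, altStirlingSum_succ, pow_succ, mul_assoc]
    have key : ∀ u, (-1 : ℤ) ^ u * altStirlingSumShift u h +
        (-1) ^ (u + 1) * altStirlingSumShift (u + 1) h =
        (-1) ^ u * altStirlingSumShift u (fun m => -(m * h m - (m + 1) * h (m + 1))) := by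
      intro u
      have : altStirlingSumShift u h = altStirlingSumShift (u + 1) h +
          altStirlingSumShift u (fun m => -(m * h m - (m + 1) * h (m + 1))) := by
        rw [altStirlingSumShift_succ, ← altStirlingSumShift_add]
        congr 1
        funext m
        ring
      rw [this]
      ring
    simp only [key]
    rw [ih]
    simp only [altStirlingSum, mul_neg, Finset.sum_neg_distrib, neg_mul, one_mul]

/-- A consequence of `S(n + 2, m + 1) = (m + 1) S(n + 1, m + 1) + S(n + 1, m)`. The upper index
must be positive, so that the term `m = 0` of the left-hand side vanishes. -/
theorem altStirlingSum_eq_shift_sub (n : ℕ) (h : ℕ → ℤ) :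
    altStirlingSum (n + 1) h = altStirlingSum (n + 1) (fun m => h (m + 1)) -
      altStirlingSumShift (n + 1) (fun m => h (m + 1)) := by
  rw [altStirlingSum_eq_sum_range_succ (n + 1) h, Finset.sum_range_succ',
    Nat.stirlingSecond_succ_zero, altStirlingSum, altStirlingSumShift, ← Finset.sum_sub_distrib]
  simp only [Nat.cast_zero, mul_zero, zero_mul, add_zero]
  refine Finset.sum_congr rfl fun m _ => ?_
  rw [Nat.stirlingSecond_succ_succ (n + 1) m, Nat.factorial_succ]
  push_cast
  ring

/-! ### The chromatic polynomial of a complete bipartite graph -/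

/-- Maps `Fin n → Fin q` counted by the size of their image: there are `S(n, m) q (q - 1) ⋯
(q - m + 1)` of them with an image of size `m`. -/
theorem sum_card_image (n q : ℕ) (h : ℕ → ℤ) :
    ∑ f : Fin n → Fin q, h (Finset.univ.image f).card =
      ∑ m ∈ Finset.range (n + 1),
        (n.stirlingSecond m : ℤ) * (descPochhammer ℤ m).eval (q : ℤ) * h m := by
  induction n generalizing h with
  | zero => simp
  | succ n ih =>
    -- the value at the new point either repeats one of `m` old values or is one of `q - m` new ones
    have step : ∑ f : Fin (n + 1) → Fin q, h (Finset.univ.image f).card =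
        ∑ f : Fin n → Fin q, (fun m : ℕ => (m : ℤ) * h m + ((q : ℤ) - m) * h (m + 1))
          (Finset.univ.image f).card := by
      rw [← (Fin.consEquiv fun _ : Fin (n + 1) => Fin q).sum_comp, Fintype.sum_prod_type,
        Finset.sum_comm]
      refine Finset.sum_congr rfl fun f _ => ?_
      have himg : ∀ c : Fin q, Finset.univ.image (Fin.cons c f : Fin (n + 1) → Fin q) =
          insert c (Finset.univ.image f) := by
        intro c
        ext x
        simp [Fin.exists_fin_succ, eq_comm]
      have hc : ∀ c : Fin q, h (insert c (Finset.univ.image f)).card =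
          if c ∈ Finset.univ.image f then h (Finset.univ.image f).card
          else h ((Finset.univ.image f).card + 1) := by
        intro c
        split_ifs with hc
        · rw [Finset.insert_eq_of_mem hc]
        · rw [Finset.card_insert_of_notMem hc]
      have hcompl : ((Finset.univ.filter fun c : Fin q => c ∉ Finset.univ.image f).card : ℤ) =
          q - (Finset.univ.image f).card := by
        have := Finset.card_add_card_compl (Finset.univ.image f)
        rw [Fintype.card_fin] at this
        have hs : (Finset.univ.filter fun c : Fin q => c ∉ Finset.univ.image f) =
            (Finset.univ.image f)ᶜ := by
          ext c
          simp
        rw [hs]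
        omega
      change ∑ c : Fin q, h (Finset.univ.image (Fin.cons c f : Fin (n + 1) → Fin q)).card = _
      simp only [himg, hc]
      rw [Finset.sum_ite, Finset.sum_const, Finset.sum_const, nsmul_eq_mul, nsmul_eq_mul, hcompl,
        Finset.filter_univ_mem]
    rw [step, ih fun m : ℕ => (m : ℤ) * h m + ((q : ℤ) - m) * h (m + 1),
      Finset.sum_range_succ' _ (n + 1), Nat.stirlingSecond_succ_zero]
    have h0 : ∑ m ∈ Finset.range (n + 1), (n.stirlingSecond m : ℤ) *
          (descPochhammer ℤ m).eval (q : ℤ) * (m * h m) =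
        ∑ m ∈ Finset.range (n + 1), (n.stirlingSecond (m + 1) : ℤ) *
          (descPochhammer ℤ (m + 1)).eval (q : ℤ) * ((m + 1 : ℕ) * h (m + 1)) := by
      have := Finset.sum_range_succ' (fun m => (n.stirlingSecond m : ℤ) *
          (descPochhammer ℤ m).eval (q : ℤ) * (m * h m)) (n + 1)
      rw [Finset.sum_range_succ, Nat.stirlingSecond_eq_zero_of_lt (Nat.lt_succ_self n)] at this
      simpa using this
    simp only [mul_add, Finset.sum_add_distrib, h0]
    rw [← Finset.sum_add_distrib]
    simp only [Nat.cast_zero, zero_mul, add_zero]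
    refine Finset.sum_congr rfl fun m _ => ?_
    rw [Nat.stirlingSecond_succ_succ, descPochhammer_succ_eval]
    push_cast
    ring

/-- A proper coloring of `K_{n,k}` is a coloring of the left part together with a coloring of the
right part that avoids the colors used on the left. -/
def completeBipartiteColoringEquiv (V W γ : Type*) :
    (completeBipartiteGraph V W).Coloring γ ≃ Σ f : V → γ, (W → {c // c ∉ Set.range f}) where
  toFun c := ⟨fun v => c (Sum.inl v), fun w => ⟨c (Sum.inr w), by
    rintro ⟨v, hv⟩
    exact c.valid (v := Sum.inl v) (w := Sum.inr w) (by simp) hv⟩⟩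
  invFun p := SimpleGraph.Coloring.mk (Sum.elim p.1 fun w => (p.2 w : γ)) (by
    rintro (v | w) (v' | w') hadj
    · simp at hadj
    · exact fun he => (p.2 w').2 ⟨v, he⟩
    · exact fun he => (p.2 w).2 ⟨v', he.symm⟩
    · simp at hadj)
  left_inv c := by
    refine DFunLike.ext _ _ ?_
    rintro (v | w) <;> rfl
  right_inv p := rfl

theorem chromaticPolynomial_completeBipartiteGraph (n k : ℕ) :
    chromaticPolynomial (completeBipartiteGraph (Fin n) (Fin k)) =
      ∑ m ∈ Finset.range (n + 1), (n.stirlingSecond m : Polynomial ℤ) * descPochhammer ℤ m *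
        (Polynomial.X - (m : Polynomial ℤ)) ^ k := by
  refine (existsUnique_chromaticPolynomial _).unique (chromaticPolynomial_eval _) fun q => ?_
  rw [Nat.card_congr (completeBipartiteColoringEquiv _ _ _), Nat.card_sigma]
  have hcard : ∀ f : Fin n → Fin q, ((Nat.card (Fin k → {c // c ∉ Set.range f}) : ℕ) : ℤ) =
      (fun m : ℕ => ((q : ℤ) - m) ^ k) (Finset.univ.image f).card := by
    intro f
    have h1 : Nat.card {c // c ∉ Set.range f} = (Finset.univ.image f)ᶜ.card := by
      rw [Nat.card_eq_fintype_card, Fintype.card_subtype]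
      congr 1
      ext c
      simp
    rw [Nat.card_fun, Nat.card_fin, h1]
    have := Finset.card_add_card_compl (Finset.univ.image f)
    rw [Fintype.card_fin] at this
    simp only [← this]
    push_cast
    ring
  push_cast
  simp only [hcard]
  rw [sum_card_image n q (fun m : ℕ => ((q : ℤ) - m) ^ k), Polynomial.eval_finsetSum]
  refine Finset.sum_congr rfl fun m _ => ?_
  simp

theorem descPochhammer_eval_neg_one (m : ℕ) :
    (descPochhammer ℤ m).eval (-1) = (-1) ^ m * m.factorial := by
  induction m with
  | zero => simp
  | succ m ih =>
    rw [descPochhammer_succ_eval, ih, Nat.factorial_succ]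
    push_cast
    ring

theorem derivative_descPochhammer_succ_eval_zero (m : ℕ) :
    (Polynomial.derivative (descPochhammer ℤ (m + 1))).eval 0 = (-1) ^ m * m.factorial := by
  rw [descPochhammer_succ_left, ← descPochhammer_eval_neg_one]
  simp [Polynomial.derivative_mul]

theorem derivative_descPochhammer_succ_succ_eval_one (m : ℕ) :
    (Polynomial.derivative (descPochhammer ℤ (m + 2))).eval 1 = (-1) ^ m * m.factorial := by
  rw [descPochhammer_succ_left, Polynomial.derivative_mul, Polynomial.derivative_comp]
  simp only [Polynomial.eval_add, Polynomial.eval_mul, Polynomial.eval_comp]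
  simp [derivative_descPochhammer_succ_eval_zero]

theorem chromaticPolynomial_completeBipartiteGraph_eval_neg_one (n k : ℕ) :
    (chromaticPolynomial (completeBipartiteGraph (Fin n) (Fin k))).eval (-1) =
      (-1) ^ k * altStirlingSum n (fun m => (m + 1) ^ k) := by
  rw [chromaticPolynomial_completeBipartiteGraph, Polynomial.eval_finsetSum, altStirlingSum,
    Finset.mul_sum]
  refine Finset.sum_congr rfl fun m _ => ?_
  have : (-1 - (m : ℤ)) ^ k = (-1) ^ k * (m + 1) ^ k := by rw [← mul_pow]; ring
  simp only [Polynomial.eval_mul, Polynomial.eval_natCast, Polynomial.eval_pow,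
    Polynomial.eval_sub, Polynomial.eval_X, descPochhammer_eval_neg_one, this]
  ring

theorem chromaticPolynomial_completeBipartiteGraph_coeff_one (n k : ℕ) :
    (chromaticPolynomial (completeBipartiteGraph (Fin n) (Fin (k + 1)))).coeff 1 =
      (-1) ^ k * altStirlingSum n (fun m => m ^ k) := by
  have h1 : ∀ p : Polynomial ℤ, p.coeff 1 = (Polynomial.derivative p).eval 0 := by
    intro p
    rw [← Polynomial.coeff_zero_eq_eval_zero, Polynomial.coeff_derivative]
    simp
  rw [h1, chromaticPolynomial_completeBipartiteGraph, Polynomial.derivative_sum,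
    Polynomial.eval_finsetSum, altStirlingSum, Finset.mul_sum]
  refine Finset.sum_congr rfl fun m _ => ?_
  cases m with
  | zero =>
    cases k with
    | zero => simp
    | succ k => simp [Polynomial.derivative_mul, Polynomial.derivative_pow]
  | succ m =>
    have h2 : (-((m : ℤ) + 1)) ^ (k + 1) = (-1) ^ (k + 1) * (m + 1) ^ (k + 1) := by
      rw [← mul_pow]; ring
    have h3 : (0 : ℤ) - ((m + 1 : ℕ) : ℤ) = -((m : ℤ) + 1) := by push_cast; ring
    simp only [Polynomial.derivative_mul, Polynomial.derivative_natCast, Polynomial.eval_add,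
      Polynomial.eval_mul, Polynomial.eval_natCast, Polynomial.eval_pow, Polynomial.eval_sub,
      Polynomial.eval_X, derivative_descPochhammer_succ_eval_zero, descPochhammer_eval_zero, h2,
      h3, Nat.factorial_succ, if_neg (Nat.succ_ne_zero m), Polynomial.eval_zero]
    push_cast
    ring

theorem derivative_chromaticPolynomial_completeBipartiteGraph_eval_one (n k : ℕ) :
    (Polynomial.derivative (chromaticPolynomial
      (completeBipartiteGraph (Fin (n + 1)) (Fin (k + 1))))).eval 1 =
      (-1) ^ k * altStirlingSumShift n (fun m => m ^ k) := by
  rw [chromaticPolynomial_completeBipartiteGraph, Finset.sum_range_succ',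
    Nat.stirlingSecond_succ_zero, Nat.cast_zero, zero_mul, zero_mul, add_zero,
    Polynomial.derivative_sum, Polynomial.eval_finsetSum, altStirlingSumShift, Finset.mul_sum]
  refine Finset.sum_congr rfl fun m _ => ?_
  cases m with
  | zero =>
    cases k with
    | zero => simp [Polynomial.derivative_mul]
    | succ k => simp [Polynomial.derivative_mul, Polynomial.derivative_pow]
  | succ m =>
    have h2 : (-((m : ℤ) + 1)) ^ (k + 1) = (-1) ^ (k + 1) * (m + 1) ^ (k + 1) := by
      rw [← mul_pow]; ring
    have h3 : (1 : ℤ) - ((m + 1 + 1 : ℕ) : ℤ) = -((m : ℤ) + 1) := by push_cast; ring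
    have h4 : (descPochhammer ℤ (m + 2)).eval 1 = 0 := by
      exact_mod_cast descPochhammer_eval_coe_nat_of_lt (R := ℤ) (k := 1) (n := m + 2) (by omega)
    simp only [Polynomial.derivative_mul, Polynomial.derivative_natCast, Polynomial.eval_add,
      Polynomial.eval_mul, Polynomial.eval_natCast, Polynomial.eval_pow, Polynomial.eval_sub,
      Polynomial.eval_X, derivative_descPochhammer_succ_succ_eval_one, h4, h2, h3,
      Nat.factorial_succ, Polynomial.eval_zero]
    push_cast
    ring

/-! ### The poly-Bernoulli numbers -/

theorem derivative_oneSubExpNeg :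
    PowerSeries.derivative ℚ oneSubExpNeg = 1 - oneSubExpNeg := by
  ext n
  rw [PowerSeries.coeff_derivative, oneSubExpNeg, sub_sub_cancel, map_sub,
    PowerSeries.coeff_rescale, PowerSeries.coeff_rescale, PowerSeries.coeff_exp,
    PowerSeries.coeff_exp, PowerSeries.coeff_one, Nat.factorial_succ]
  have : (n.factorial : ℚ) ≠ 0 := by positivity
  simp
  field_simp
  ring

/-- The exponential generating function `(1 - e^{-x})^i = ∑_n (-1)^{n+i} i! S(n, i) x^n / n!`. -/
theorem factorial_mul_coeff_oneSubExpNeg_pow (n i : ℕ) :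
    (n.factorial : ℚ) * PowerSeries.coeff n (oneSubExpNeg ^ i) =
      (-1) ^ (n + i) * i.factorial * n.stirlingSecond i := by
  have h0 : PowerSeries.constantCoeff oneSubExpNeg = 0 := by
    rw [← PowerSeries.coeff_zero_eq_constantCoeff_apply, oneSubExpNeg, map_sub,
      PowerSeries.coeff_rescale, PowerSeries.coeff_exp]
    simp
  induction n generalizing i with
  | zero =>
    cases i with
    | zero => simp
    | succ i => simp [h0]
  | succ n ih =>
    cases i with
    | zero => simp [PowerSeries.coeff_one]
    | succ i =>
      -- `g = 1 - e^{-x}` satisfies `g' = 1 - g`, so `(g^{i+1})' = (i + 1) (g^i - g^{i+1})`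
      have hd : PowerSeries.derivative ℚ (oneSubExpNeg ^ (i + 1)) =
          PowerSeries.C ((i : ℚ) + 1) * (oneSubExpNeg ^ i - oneSubExpNeg ^ (i + 1)) := by
        rw [PowerSeries.derivative_pow, derivative_oneSubExpNeg]
        simp
        ring
      have hc := congrArg (PowerSeries.coeff n) hd
      rw [PowerSeries.coeff_derivative, PowerSeries.coeff_C_mul, map_sub] at hc
      have h1 := ih i
      have h2 := ih (i + 1)
      rw [Nat.stirlingSecond_succ_succ, Nat.factorial_succ n]
      push_cast
      calc ((n : ℚ) + 1) * n.factorial * PowerSeries.coeff (n + 1) (oneSubExpNeg ^ (i + 1))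
          = n.factorial *
              (PowerSeries.coeff (n + 1) (oneSubExpNeg ^ (i + 1)) * ((n : ℚ) + 1)) := by ring
        _ = ((i : ℚ) + 1) * (n.factorial * PowerSeries.coeff n (oneSubExpNeg ^ i) -
              n.factorial * PowerSeries.coeff n (oneSubExpNeg ^ (i + 1))) := by rw [hc]; ring
        _ = _ := by
          rw [h1, h2, Nat.factorial_succ]
          push_cast
          ring

theorem polyBernoulliB_eq_altStirlingSum (n k : ℕ) :
    polyBernoulliB n k = (((-1) ^ n * altStirlingSum n (fun m => (m + 1) ^ k) : ℤ) : ℚ) := by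
  rw [polyBernoulliB, kanekoPolyBernoulli, polyBernoulliGenFun,
    PowerSeries.coeff_subst' hasSubst_oneSubExpNeg]
  have hn : (n.factorial : ℚ) ≠ 0 := by positivity
  rw [finsum_eq_sum_of_support_subset (s := Finset.range (n + 1)), Finset.mul_sum, altStirlingSum,
    Finset.mul_sum, Int.cast_sum]
  · refine Finset.sum_congr rfl fun i _ => ?_
    rw [smul_eq_mul, mul_left_comm, factorial_mul_coeff_oneSubExpNeg_pow, polylogDivSeries,
      PowerSeries.coeff_mk, zpow_neg, zpow_natCast, one_div, inv_inv]
    push_cast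
    ring
  · intro i hi
    rw [Finset.coe_range, Set.mem_Iio]
    by_contra hlt
    apply hi
    have := factorial_mul_coeff_oneSubExpNeg_pow n i
    rw [Nat.stirlingSecond_eq_zero_of_lt (by omega), Nat.cast_zero, mul_zero] at this
    simp [(mul_eq_zero.mp this).resolve_left hn]

/-! ### Lonesum matrices and Ferrers matrices -/

/-- A `01` matrix is Ferrers if it has no `2 × 2` submatrix that is a permutation matrix;
equivalently, its columns, as sets of rows, form a chain. -/
def IsFerrers {α β : Type*} (M : α → β → Bool) : Prop :=
  ∀ i i' j j', M i j = true → M i' j' = true → M i j' = true ∨ M i' j = true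

theorem IsLonesum.isFerrers {n k : ℕ} {M : Matrix (Fin n) (Fin k) Bool} (hM : IsLonesum M) :
    IsFerrers M := by
  intro i i' j j' h1 h2
  by_contra! hne
  obtain ⟨h3, h4⟩ := hne
  replace h3 : M i j' = false := Bool.eq_false_of_not_eq_true h3
  replace h4 : M i' j = false := Bool.eq_false_of_not_eq_true h4
  have hi : i ≠ i' := by rintro rfl; simp_all
  have hj : j ≠ j' := by rintro rfl; simp_all
  -- exchanging the two rows (equivalently, columns) of the bad submatrix keeps all the sums
  let M' : Matrix (Fin n) (Fin k) Bool := fun a b =>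
    if a = i ∨ a = i' then M a (Equiv.swap j j' b) else M a b
  have hM' : M' = M := by
    refine hM M' ?_ ?_
    · funext a
      simp only [rowSum, M']
      split_ifs with ha
      · exact Equiv.sum_comp (Equiv.swap j j') fun b => (M a b).toNat
      · rfl
    · have hcol : ∀ a b, M' a b = if b = j ∨ b = j' then M (Equiv.swap i i' a) b else M a b := by
        intro a b
        simp only [M']
        by_cases ha : a = i <;> by_cases ha' : a = i' <;> by_cases hb : b = j <;>
          by_cases hb' : b = j' <;> simp_all [Equiv.swap_apply_of_ne_of_ne]
      funext b
      simp only [colSum, hcol]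
      split_ifs with hb
      · exact Equiv.sum_comp (Equiv.swap i i') fun a => (M a b).toNat
      · rfl
  have := congrFun (congrFun hM' i) j
  simp [M', h1, h3] at this

/-- The rows of a Ferrers matrix form a chain, so a column consists of the rows with the largest
row sums. -/
theorem IsFerrers.exists_threshold {n k : ℕ} {M : Matrix (Fin n) (Fin k) Bool}
    (hM : IsFerrers M) (j : Fin k) : ∃ t : ℕ, ∀ i, M i j = true ↔ t ≤ rowSum M i := by
  classical
  -- a row with at least as many ones contains any row it is compared with
  have hmono : ∀ i i', M i j = true → rowSum M i ≤ rowSum M i' → M i' j = true := by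
    intro i i' hi hle
    by_contra hi'
    have hsub : ∀ b, M i' b = true → M i b = true := fun b hb =>
      (hM i i' j b hi hb).resolve_right hi'
    refine absurd hle (not_le.mpr (Finset.sum_lt_sum (fun b _ => ?_) ⟨j, Finset.mem_univ _, ?_⟩))
    · exact Bool.toNat_le_toNat (fun hb => hsub b hb)
    · simp [hi, Bool.eq_false_of_not_eq_true hi']
  have hex : ∃ t : ℕ, ∀ i, t ≤ rowSum M i → M i j = true :=
    ⟨(∑ i, rowSum M i) + 1, fun i hi => absurd
      (Finset.single_le_sum (f := rowSum M) (fun _ _ => Nat.zero_le _) (Finset.mem_univ i))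
      (by omega)⟩
  exact ⟨Nat.find hex, fun i => ⟨fun hi => Nat.find_min' hex fun i' => hmono i i' hi,
    Nat.find_spec hex i⟩⟩

/-- With row weights `2 r_i` (twice the row sums) and column weights `1 - 2 t_j` (`t_j` the
thresholds), a Ferrers matrix has its ones exactly at the entries of positive weight, so it is
the unique maximizer of the total weight, which depends on the row and column sums only. -/
theorem IsFerrers.isLonesum {n k : ℕ} {M : Matrix (Fin n) (Fin k) Bool} (hM : IsFerrers M) :
    IsLonesum M := by
  intro M' hr hc
  choose t ht using hM.exists_threshold
  let x : Fin n → Fin k → ℤ := fun i j => (M i j).toNat - (M' i j).toNat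
  have hrow : ∀ i, ∑ j, x i j = 0 := by
    intro i
    have := congrFun hr i
    simp only [rowSum] at this
    simp only [x, Finset.sum_sub_distrib]
    exact_mod_cast sub_eq_zero.mpr (congrArg (Nat.cast (R := ℤ)) this.symm)
  have hcol : ∀ j, ∑ i, x i j = 0 := by
    intro j
    have := congrFun hc j
    simp only [colSum] at this
    simp only [x, Finset.sum_sub_distrib]
    exact_mod_cast sub_eq_zero.mpr (congrArg (Nat.cast (R := ℤ)) this.symm)
  have hsum : ∑ i, ∑ j, x i j * (2 * rowSum M i + (1 - 2 * t j)) = 0 := by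
    simp only [mul_add, Finset.sum_add_distrib]
    rw [Finset.sum_comm (f := fun i j => x i j * (1 - 2 * (t j : ℤ)))]
    simp only [← Finset.sum_mul, hrow, hcol]
    simp
  have hnn : ∀ i j, 0 ≤ x i j * (2 * rowSum M i + (1 - 2 * t j)) := by
    intro i j
    have h := ht j i
    simp only [x]
    cases hij : M i j <;> cases M' i j <;> simp [hij] at h ⊢ <;> omega
  funext i j
  have hz : x i j * (2 * rowSum M i + (1 - 2 * t j)) = 0 := by
    have h1 := (Finset.sum_eq_zero_iff_of_nonneg
      (fun i _ => Finset.sum_nonneg fun j _ => hnn i j)).mp hsum i (Finset.mem_univ _)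
    exact (Finset.sum_eq_zero_iff_of_nonneg fun j _ => hnn i j).mp h1 j (Finset.mem_univ _)
  have hx : x i j = 0 := (mul_eq_zero.mp hz).resolve_right (by omega)
  simp only [x] at hx
  cases hij : M i j <;> cases hij' : M' i j <;> simp_all

theorem isLonesum_iff_isFerrers {n k : ℕ} (M : Matrix (Fin n) (Fin k) Bool) :
    IsLonesum M ↔ IsFerrers M :=
  ⟨IsLonesum.isFerrers, IsFerrers.isLonesum⟩

/-! ### Counting Ferrers matrices -/

/-- The type of Ferrers matrices without all-`0` columns. -/
def FerrersC (α β : Type*) : Type _ :=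
  {M : α → β → Bool // IsFerrers M ∧ ∀ j, ∃ i, M i j = true}

/-- The type of Ferrers matrices without all-`0` columns and without all-`0` rows. -/
def FerrersD (α β : Type*) : Type _ :=
  {M : α → β → Bool // IsFerrers M ∧ (∀ j, ∃ i, M i j = true) ∧ ∀ i, ∃ j, M i j = true}

/-- The type of Ferrers matrices without all-`0` columns and without all-`1` columns. -/
def FerrersE (α β : Type*) : Type _ :=
  {M : α → β → Bool // IsFerrers M ∧ (∀ j, ∃ i, M i j = true) ∧ ∀ j, ∃ i, M i j = false}

instance {α β : Type*} [Finite α] [Finite β] : Finite (FerrersC α β) := Subtype.finite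
instance {α β : Type*} [Finite α] [Finite β] : Finite (FerrersD α β) := Subtype.finite
instance {α β : Type*} [Finite α] [Finite β] : Finite (FerrersE α β) := Subtype.finite

theorem isFerrers_congr {α β α' β' : Type*} (e : α ≃ α') (f : β ≃ β') (M : α → β → Bool) :
    IsFerrers M ↔ IsFerrers fun i j => M (e.symm i) (f.symm j) := by
  simp only [IsFerrers, e.symm.surjective.forall, f.symm.surjective.forall]

/-- Reindexing of rows and columns. -/
def FerrersD.congr {α β α' β' : Type*} (e : α ≃ α') (f : β ≃ β') :
    FerrersD α β ≃ FerrersD α' β' :=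
  (e.arrowCongr (f.arrowCongr (Equiv.refl Bool))).subtypeEquiv fun M => by
    change _ ↔ IsFerrers (fun i j => M (e.symm i) (f.symm j)) ∧
      (∀ j, ∃ i, M (e.symm i) (f.symm j) = true) ∧ ∀ i, ∃ j, M (e.symm i) (f.symm j) = true
    rw [isFerrers_congr e f]
    simp only [e.symm.surjective.forall, f.symm.surjective.forall, e.symm.surjective.exists,
      f.symm.surjective.exists]

/-- Reindexing of rows and columns. -/
def FerrersE.congr {α β α' β' : Type*} (e : α ≃ α') (f : β ≃ β') :
    FerrersE α β ≃ FerrersE α' β' :=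
  (e.arrowCongr (f.arrowCongr (Equiv.refl Bool))).subtypeEquiv fun M => by
    change _ ↔ IsFerrers (fun i j => M (e.symm i) (f.symm j)) ∧
      (∀ j, ∃ i, M (e.symm i) (f.symm j) = true) ∧ ∀ j, ∃ i, M (e.symm i) (f.symm j) = false
    rw [isFerrers_congr e f]
    simp only [f.symm.surjective.forall, e.symm.surjective.exists]

theorem lonesumC_eq_card (n k : ℕ) : lonesumC n k = Nat.card (FerrersC (Fin n) (Fin k)) := by
  simp only [lonesumC, isLonesum_iff_isFerrers]
  rfl

theorem lonesumD_eq_card (n k : ℕ) : lonesumD n k = Nat.card (FerrersD (Fin n) (Fin k)) := by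
  simp only [lonesumD, isLonesum_iff_isFerrers]
  rfl

section Fibers

variable {α β : Type*} [Fintype α] [Fintype β] [DecidableEq α] [DecidableEq β]

/-- The nonzero rows of a matrix. -/
def rowSupport (M : FerrersC α β) : Finset α := {i | ∃ j, M.1 i j = true}

/-- The columns of a matrix that are not all-`1`. -/
def properColumns (M : FerrersC α β) : Finset β := {j | ∃ i, M.1 i j = false}

/-- Matrices with set of nonzero rows `U` are matrices on `U` without all-`0` rows. -/
def rowSupportFiberEquiv (U : Finset α) :
    {M : FerrersC α β // rowSupport M = U} ≃ FerrersD U β where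
  toFun M := ⟨fun i j => M.1.1 i j, fun i i' j j' => M.1.2.1 i i' j j', fun j => by
    obtain ⟨i, hi⟩ := M.1.2.2 j
    exact ⟨⟨i, by rw [← M.2]; simpa [rowSupport] using ⟨j, hi⟩⟩, hi⟩, fun i => by
    have : (i : α) ∈ rowSupport M.1 := M.2.symm ▸ i.2
    simpa [rowSupport] using this⟩
  invFun N := ⟨⟨fun i j => if h : i ∈ U then N.1 ⟨i, h⟩ j else false, fun i i' j j' h1 h2 => by
      by_cases hi : i ∈ U <;> by_cases hi' : i' ∈ U <;> simp [hi, hi'] at h1 h2 ⊢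
      exact N.2.1 _ _ j j' h1 h2, fun j => by
      obtain ⟨i, hi⟩ := N.2.2.1 j
      exact ⟨i, by simpa using hi⟩⟩, by
    ext i
    by_cases hi : i ∈ U
    · simpa [rowSupport, hi] using N.2.2.2 ⟨i, hi⟩
    · simp [rowSupport, hi]⟩
  left_inv M := by
    refine Subtype.ext (Subtype.ext ?_)
    funext i j
    by_cases hi : i ∈ U
    · simp [hi]
    · have := hi
      rw [← M.2] at this
      simp [rowSupport] at this
      simp [hi, this j]
  right_inv N := by
    refine Subtype.ext ?_
    funext i j
    simp

/-- Matrices whose set of not all-`1` columns is `S` are matrices on `S` without all-`1`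
columns. There has to be a row, as otherwise all-`1` columns are all-`0`. -/
def properColumnsFiberEquiv [Nonempty α] (S : Finset β) :
    {M : FerrersC α β // properColumns M = S} ≃ FerrersE α S where
  toFun M := ⟨fun i j => M.1.1 i j, fun i i' j j' => M.1.2.1 i i' j j', fun j => M.1.2.2 j,
    fun j => by
      have : (j : β) ∈ properColumns M.1 := M.2.symm ▸ j.2
      simpa [properColumns] using this⟩
  invFun N := ⟨⟨fun i j => if h : j ∈ S then N.1 i ⟨j, h⟩ else true, fun i i' j j' h1 h2 => by
      by_cases hj : j ∈ S <;> by_cases hj' : j' ∈ S <;> simp [hj, hj'] at h1 h2 ⊢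
      exact N.2.1 _ _ _ _ h1 h2, fun j => by
      by_cases hj : j ∈ S
      · simpa [hj] using N.2.2.1 ⟨j, hj⟩
      · simp [hj]⟩, by
    ext j
    by_cases hj : j ∈ S
    · simpa [properColumns, hj] using N.2.2.2 ⟨j, hj⟩
    · simp [properColumns, hj]⟩
  left_inv M := by
    refine Subtype.ext (Subtype.ext ?_)
    funext i j
    by_cases hj : j ∈ S
    · simp [hj]
    · have := hj
      rw [← M.2] at this
      simp [properColumns] at this
      simp [hj, this i]
  right_inv N := by
    refine Subtype.ext ?_
    funext i j
    simp

end Fibers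

/-- Classification of the matrices by their set of nonzero rows. -/
theorem lonesumC_eq_sum_lonesumD (n k : ℕ) :
    lonesumC n k = ∑ u ∈ Finset.range (n + 1), n.choose u * lonesumD u k := by
  have hfib : ∀ U : Finset (Fin n),
      Nat.card {M : FerrersC (Fin n) (Fin k) // rowSupport M = U} = lonesumD U.card k := by
    intro U
    rw [Nat.card_congr (rowSupportFiberEquiv U), lonesumD_eq_card]
    exact Nat.card_congr (FerrersD.congr (U.equivFin) (Equiv.refl _))
  rw [lonesumC_eq_card, ← Nat.card_congr (Equiv.sigmaFiberEquiv rowSupport), Nat.card_sigma]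
  simp only [hfib]
  have := Finset.sum_powerset_apply_card (fun u => lonesumD u k)
    (x := (Finset.univ : Finset (Fin n)))
  simpa using this

/-- Classification of the matrices by their set of columns that are not all-`1`. -/
theorem lonesumC_succ_eq_sum_card_FerrersE (n k : ℕ) :
    lonesumC (n + 1) k =
      ∑ l ∈ Finset.range (k + 1), k.choose l * Nat.card (FerrersE (Fin (n + 1)) (Fin l)) := by
  have hfib : ∀ S : Finset (Fin k),
      Nat.card {M : FerrersC (Fin (n + 1)) (Fin k) // properColumns M = S} =
        Nat.card (FerrersE (Fin (n + 1)) (Fin S.card)) := by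
    intro S
    rw [Nat.card_congr (properColumnsFiberEquiv S)]
    exact Nat.card_congr (FerrersE.congr (Equiv.refl _) (S.equivFin))
  rw [lonesumC_eq_card, ← Nat.card_congr (Equiv.sigmaFiberEquiv properColumns), Nat.card_sigma]
  simp only [hfib]
  have := Finset.sum_powerset_apply_card
    (fun l => Nat.card (FerrersE (Fin (n + 1)) (Fin l))) (x := (Finset.univ : Finset (Fin k)))
  simpa using this

/-- A Ferrers matrix has no all-`0` row exactly if it has an all-`1` column: a column with the
most ones contains all the others. -/
theorem IsFerrers.forall_row_iff {α β : Type*} [Finite α] [Finite β] [Nonempty α]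
    {M : α → β → Bool} (hM : IsFerrers M) :
    (∀ i, ∃ j, M i j = true) ↔ ∃ j, ∀ i, M i j = true := by
  refine ⟨fun h => ?_, fun ⟨j, hj⟩ i => ⟨j, hj i⟩⟩
  have : Nonempty β := ⟨(h (Classical.arbitrary α)).choose⟩
  obtain ⟨j, hj⟩ := Finite.exists_max fun j => {i | M i j = true}.ncard
  refine ⟨j, fun i => ?_⟩
  by_contra hi
  obtain ⟨j', hj'⟩ := h i
  refine absurd (hj j') (not_le.mpr (Set.ncard_lt_ncard ⟨fun i' hi' => ?_, fun hsub => ?_⟩))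
  · exact (hM i' i j j' hi' hj').resolve_right hi
  · exact hi (hsub hj')

/-- The matrices without all-`0` columns either have no all-`1` column or, by
`IsFerrers.forall_row_iff`, have no all-`0` row. -/
theorem card_FerrersE_add_lonesumD (n k : ℕ) :
    Nat.card (FerrersE (Fin (n + 1)) (Fin k)) + lonesumD (n + 1) k = lonesumC (n + 1) k := by
  classical
  have h1 : Nat.card (FerrersE (Fin (n + 1)) (Fin k)) =
      Nat.card {M : FerrersC (Fin (n + 1)) (Fin k) // ¬ ∃ j, ∀ i, M.1 i j = true} :=
    Nat.card_congr
      { toFun := fun M => ⟨⟨M.1, M.2.1, M.2.2.1⟩, by simpa using M.2.2.2⟩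
        invFun := fun M => ⟨M.1.1, M.1.2.1, M.1.2.2, by simpa using M.2⟩
        left_inv := fun _ => rfl
        right_inv := fun _ => rfl }
  have h2 : lonesumD (n + 1) k =
      Nat.card {M : FerrersC (Fin (n + 1)) (Fin k) // ∃ j, ∀ i, M.1 i j = true} := by
    rw [lonesumD_eq_card]
    exact Nat.card_congr
      { toFun := fun M => ⟨⟨M.1, M.2.1, M.2.2.1⟩, M.2.1.forall_row_iff.mp M.2.2.2⟩
        invFun := fun M => ⟨M.1.1, M.1.2.1, M.1.2.2, M.1.2.1.forall_row_iff.mpr M.2⟩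
        left_inv := fun _ => rfl
        right_inv := fun _ => rfl }
  rw [h1, h2, lonesumC_eq_card, add_comm, ← Nat.card_sum]
  exact Nat.card_congr (Equiv.sumCompl _)

/-- Since `FerrersE` accounts for the difference `C - D`, the classification by columns that are
not all-`1` is a linear relation between the numbers `C` and `D`. The summand
`l = k` contains `C_{n+1,k}` itself, so the equation expresses `D_{n+1,k}` by numbers with smaller
column index. -/
theorem lonesumC_succ_eq_sum (n k : ℕ) :
    (lonesumC (n + 1) k : ℤ) = ∑ l ∈ Finset.range (k + 1),
      (k.choose l : ℤ) * (lonesumC (n + 1) l - lonesumD (n + 1) l) := by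
  rw [lonesumC_succ_eq_sum_card_FerrersE]
  push_cast
  refine Finset.sum_congr rfl fun l _ => ?_
  rw [← card_FerrersE_add_lonesumD]
  push_cast
  ring

/-- The relations `lonesumC_eq_sum_lonesumD` and `lonesumC_succ_eq_sum` determine all `C_{n,k}`
and `D_{n,k}` by recursion on `k`, and the alternating Stirling sums satisfy the same relations. -/
theorem lonesumC_lonesumD_eq (k : ℕ) :
    (∀ n, (lonesumD n k : ℤ) = (-1) ^ n * altStirlingSumShift n (fun m => m ^ k)) ∧
      ∀ n, (lonesumC n k : ℤ) = (-1) ^ n * altStirlingSum n (fun m => m ^ k) := by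
  induction k using Nat.strong_induction_on with
  | _ k ih =>
    have hD : ∀ n, (lonesumD n k : ℤ) = (-1) ^ n * altStirlingSumShift n (fun m => m ^ k) := by
      intro n
      cases n with
      | zero =>
        rw [lonesumD_eq_card]
        cases k with
        | zero =>
          have : Unique (FerrersD (Fin 0) (Fin 0)) :=
            { default := ⟨fun i => i.elim0, fun i => i.elim0, fun i => i.elim0, fun i => i.elim0⟩
              uniq := fun M => Subtype.ext (funext fun i => i.elim0) }
          simp [altStirlingSumShift, Nat.stirlingSecond_one_right]
        | succ k =>
          have : IsEmpty (FerrersD (Fin 0) (Fin (k + 1))) :=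
            ⟨fun M => (M.2.2.1 0).choose.elim0⟩
          simp [altStirlingSumShift]
      | succ n =>
        -- the term `l = k` of the recurrence cancels `C_{n+1,k}` and leaves `D_{n+1,k}`
        have h1 := lonesumC_succ_eq_sum n k
        rw [Finset.sum_range_succ, Nat.choose_self, Nat.cast_one, one_mul] at h1
        have hbin : ∀ m : ℕ, ((m + 1 : ℕ) : ℤ) ^ k =
            ∑ l ∈ Finset.range (k + 1), (k.choose l : ℤ) * (m : ℤ) ^ l := by
          intro m
          push_cast
          rw [add_pow]
          exact Finset.sum_congr rfl fun l _ => by ring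
        have h2 := altStirlingSum_eq_shift_sub n (fun m => (m : ℤ) ^ k)
        simp only [hbin] at h2
        rw [altStirlingSum_sum, altStirlingSumShift_sum, ← Finset.sum_sub_distrib,
          Finset.sum_range_succ, Nat.choose_self, Nat.cast_one, one_mul, one_mul] at h2
        have h3 : ∑ l ∈ Finset.range k,
              (k.choose l : ℤ) * (lonesumC (n + 1) l - lonesumD (n + 1) l) =
            (-1) ^ (n + 1) * ∑ l ∈ Finset.range k,
              ((k.choose l : ℤ) * altStirlingSum (n + 1) (fun m => (m : ℤ) ^ l) -
                (k.choose l : ℤ) * altStirlingSumShift (n + 1) (fun m => (m : ℤ) ^ l)) := by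
          rw [Finset.mul_sum]
          refine Finset.sum_congr rfl fun l hl => ?_
          rw [(ih l (Finset.mem_range.mp hl)).1, (ih l (Finset.mem_range.mp hl)).2]
          ring
        rw [h3] at h1
        linear_combination h1 - (-1) ^ (n + 1) * h2
    refine ⟨hD, fun n => ?_⟩
    rw [lonesumC_eq_sum_lonesumD, ← sum_choose_mul_altStirlingSumShift]
    push_cast
    exact Finset.sum_congr rfl fun u _ => by rw [hD]

theorem theorem20 (n k : ℕ) :
    (polyBernoulliB n k =
      (-1 : ℚ) ^ (n + k) *
        (((chromaticPolynomial (completeBipartiteGraph (Fin n) (Fin k))).eval (-1) : ℤ) : ℚ)) ∧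
    ((lonesumC n k : ℤ) =
      (-1) ^ (n + k) *
        (chromaticPolynomial (completeBipartiteGraph (Fin n) (Fin (k + 1)))).coeff 1) ∧
    ((lonesumD n k : ℤ) =
      (-1) ^ (n + k) *
        (Polynomial.derivative
          (chromaticPolynomial
            (completeBipartiteGraph (Fin (n + 1)) (Fin (k + 1))))).eval 1) := by
  have hsign : ∀ a : ℤ, (-1) ^ (n + k) * ((-1) ^ k * a) = (-1) ^ n * a := by
    intro a
    rw [← mul_assoc, ← pow_add, add_assoc, ← two_mul, pow_add, pow_mul _ 2]
    simp
  refine ⟨?_, ?_, ?_⟩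
  · rw [polyBernoulliB_eq_altStirlingSum, chromaticPolynomial_completeBipartiteGraph_eval_neg_one,
      ← hsign]
    push_cast
    rfl
  · rw [chromaticPolynomial_completeBipartiteGraph_coeff_one, hsign]
    exact (lonesumC_lonesumD_eq k).2 n
  · rw [derivative_chromaticPolynomial_completeBipartiteGraph_eval_one, hsign]
    exact (lonesumC_lonesumD_eq k).1 n
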